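/- Let $\varphi\in L^1(\mathbb R)$ (complex valued) be nontrivial, i.e. not almost everywhere zero. For $s\ge 0$ put $$p(s)=-\log\int_{|t|\ge s}|\varphi(t)|\,dt\in(-\infty,+\infty],$$ with $p(s)=+\infty$ if the integral vanishes, and assume that $\lim_{s\to\infty}p(s)/s=\infty$. Let $\widehat\varphi(x)=\int_{-\infty}^{\infty}e^{-ixt}\varphi(t)\,dt$ for $x\in\mathbb R$, and for $\epsilon>0$ let $s_\epsilon=\inf\{s>0:\ e^{-p(s)}\le\epsilon\}$. Let $q>\frac12$ and $\beta>0$ be constants. Then there is $\epsilon_0>0$ (depending on $\varphi,q,\beta$) such that for every $0<\epsilon<\epsilon_0$ the equation $$\Big[\big(q+\tfrac12\big)\log R_\epsilon+\log(15e^3)\Big]\Big[\log\|\varphi\|_{L^1(\mathbb R)}+2e\,s_\epsilon R_\epsilon\Big]=-\log(\epsilon^\beta+\epsilon)$$ has a solution $R_\epsilon>0$, and every solution $R_\epsilon>0$ satisfies $$m\big(\{x\in\mathbb R:\ |\widehat\varphi(x)|\le\epsilon^\beta,\ |x|\le R_\epsilon\}\big)\le R_\epsilon^{-q+\frac12},$$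 where $m$ is Lebesgue measure on $\mathbb R$. -/

import Mathlib

open MeasureTheory Filter Topology

noncomputable section

namespace Deconvolution

/-- The Fourier transform `∫ e^{-ixt} φ(t) dt`, with this normalisation. -/
def fourierHat (φ : ℝ → ℂ) (x : ℝ) : ℂ :=
  ∫ t : ℝ, Complex.exp (-(Complex.I * (x : ℂ) * (t : ℂ))) * φ t

/-- `p(s) = - log ∫_{|t| ≥ s} |φ(t)| dt`, extended-real valued: it is `⊤` (that is `-log 0`)
as soon as `φ` vanishes almost everywhere on `{|t| ≥ s}`. -/
def tailExponent (φ : ℝ → ℂ) (s : ℝ) : EReal :=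
  -ENNReal.log (∫⁻ t in {t : ℝ | s ≤ |t|}, ‖φ t‖ₑ)

/-- `s_ε = inf {s > 0 : e^{-p(s)} ≤ ε}`. -/
def truncationRadius (φ : ℝ → ℂ) (ε : ℝ) : ℝ :=
  sInf {s : ℝ | 0 < s ∧ EReal.exp (-tailExponent φ s) ≤ ENNReal.ofReal ε}

/-- The implicit equation that `R = R_ε` has to satisfy. -/
def RadiusEquation (φ : ℝ → ℂ) (q β ε R : ℝ) : Prop :=
  ((q + 1 / 2) * Real.log R + Real.log (15 * Real.exp 1 ^ 3)) *
      (Real.log (∫ t : ℝ, ‖φ t‖) + 2 * Real.exp 1 * truncationRadius φ ε * R) =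
    -Real.log (ε ^ β + ε)

/-- The real small-value set `{x ∈ ℝ : |φ̂(x)| ≤ δ, |x| ≤ R}`. -/
def smallValueSet (φ : ℝ → ℂ) (δ R : ℝ) : Set ℝ :=
  {x : ℝ | ‖fourierHat φ x‖ ≤ δ ∧ |x| ≤ R}

end Deconvolution

end

/-! Cutting `φ` off at a radius close to `s_ε` changes its transform on the real line by at most `ε`
and leaves an entire function `F` of exponential type. On the small-value set `|F| ≤ ε^β + ε`, so
the claim reduces to a Cartan-type estimate (`log_ge_of_norm_le_on`): an entire function bounded by
`B` on a large circle, and at least `c` in modulus at the centre, cannot be too small on a real set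
of measure `m`.

For that estimate write `F = P g`, where `P` is a monic polynomial and `g` has no zeros in the disc.
A Jensen-type count gives `deg P ≤ log (B / c)`. Borel–Carathéodory applied to `log g` bounds `|g|`
below, and averaging `log |P|` over the set gives a point where `|P|` is not small. With a centre
`x₀` where the transform of `φ` is nonzero, the bound contradicts the radius equation if `m > R ^
(-q + 1 / 2)` and `R` is large (`eventually_lt_log_of_norm_le_on`).

Solutions are large or trivial. If the logarithmic factor is negative, `R` is so small that `2R ≤ R
^ (-q + 1 / 2)`. Otherwise, since `s_ε = o(log (1 / ε))`, a bounded `R` would make the left side too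
small. -/

namespace Deconvolution

/-! ### Lower bounds for zero-free holomorphic functions -/

/-- A zero-free holomorphic function on a disc has a holomorphic logarithm there. -/
theorem exists_log_on_ball {g : ℂ → ℂ} {r : ℝ} (hr : 0 < r)
    (hg : DifferentiableOn ℂ g (Metric.ball 0 r)) (h0 : ∀ z ∈ Metric.ball (0 : ℂ) r, g z ≠ 0) :
    ∃ h : ℂ → ℂ, DifferentiableOn ℂ h (Metric.ball 0 r) ∧ h 0 = 0 ∧
      ∀ z ∈ Metric.ball (0 : ℂ) r, g z = g 0 * Complex.exp (h z) := by
  have hd : DifferentiableOn ℂ (fun z => deriv g z / g z) (Metric.ball 0 r) :=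
    (hg.deriv Metric.isOpen_ball).div hg h0
  obtain ⟨h, hh0, hh⟩ := hd.isExactOn_ball.with_val_at 0 0
  have h0r : (0 : ℂ) ∈ Metric.ball (0 : ℂ) r := Metric.mem_ball_self hr
  refine ⟨h, fun z hz => (hh z hz).differentiableAt.differentiableWithinAt, hh0, ?_⟩
  have hder : ∀ z ∈ Metric.ball (0 : ℂ) r,
      HasDerivAt (fun w => g w * Complex.exp (-h w)) 0 z := by
    intro z hz
    have h1 := (hg.differentiableAt (Metric.isOpen_ball.mem_nhds hz)).hasDerivAt
    have h2 := h1.mul ((hh z hz).neg.cexp)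
    refine h2.congr_deriv ?_
    have := h0 z hz
    field_simp
    ring
  intro z hz
  have hconst := Metric.isOpen_ball.is_const_of_deriv_eq_zero
    (convex_ball (0 : ℂ) r).isPreconnected
    (fun w hw => (hder w hw).differentiableAt.differentiableWithinAt)
    (fun w hw => (hder w hw).deriv) hz h0r
  simp only [hh0, neg_zero, Complex.exp_zero, mul_one] at hconst
  rw [← hconst, mul_assoc, ← Complex.exp_add]
  simp

/-- A form of Harnack's inequality for zero-free holomorphic functions. -/
theorem log_norm_ge_of_ne_zero_on_ball {g : ℂ → ℂ} {r Q : ℝ} (hr : 0 < r) (hQ : 0 < Q)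
    (hg : DifferentiableOn ℂ g (Metric.ball 0 r)) (h0 : ∀ z ∈ Metric.ball (0 : ℂ) r, g z ≠ 0)
    (hle : ∀ z ∈ Metric.ball (0 : ℂ) r, ‖g z‖ ≤ ‖g 0‖ * Real.exp Q) {z : ℂ}
    (hz : ‖z‖ ≤ 4 / 5 * r) : ‖g 0‖ * Real.exp (-(8 * Q)) ≤ ‖g z‖ := by
  obtain ⟨h, hd, hh0, hh⟩ := exists_log_on_ball hr hg h0
  have h0r : (0 : ℂ) ∈ Metric.ball (0 : ℂ) r := Metric.mem_ball_self hr
  have hzr : z ∈ Metric.ball (0 : ℂ) r := by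
    rw [mem_ball_zero_iff]; linarith
  have hg0 : 0 < ‖g 0‖ := norm_pos_iff.2 (h0 0 h0r)
  have hmaps : Set.MapsTo h (Metric.ball 0 r) {w | w.re ≤ Q} := by
    intro w hw
    have := hle w hw
    rw [hh w hw, norm_mul, Complex.norm_exp] at this
    exact Real.exp_le_exp.1 (le_of_mul_le_mul_left this hg0)
  have hbc := Complex.borelCaratheodory_zero hQ hd hmaps hr hzr hh0
  -- At `‖z‖ = 4r/5` the Borel–Carathéodory factor is `2 * (4/5) / (1/5) = 8`.
  have h8 : 2 * Q * ‖z‖ / (r - ‖z‖) ≤ 8 * Q := by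
    rw [div_le_iff₀ (by linarith)]
    nlinarith
  have hre : -(8 * Q) ≤ (h z).re := by
    have := Complex.abs_re_le_norm (h z)
    have := neg_abs_le (h z).re
    linarith
  rw [hh z hzr, norm_mul, Complex.norm_exp]
  gcongr

/-! ### Factoring out and counting zeros -/

theorem norm_prod_sub_le {s : Multiset ℂ} {z : ℂ} {t : ℝ} (h : ∀ a ∈ s, ‖z - a‖ ≤ t) :
    ‖(s.map (fun a => z - a)).prod‖ ≤ t ^ Multiset.card s := by
  induction s using Multiset.induction_on with
  | empty => simp
  | cons a s ih =>
    have ht : 0 ≤ t := (norm_nonneg _).trans (h a (Multiset.mem_cons_self a s))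
    simp only [Multiset.map_cons, Multiset.prod_cons, norm_mul, Multiset.card_cons, pow_succ']
    gcongr
    · exact h a (Multiset.mem_cons_self a s)
    · exact ih fun b hb => h b (Multiset.mem_cons_of_mem hb)

theorem le_norm_prod_sub {s : Multiset ℂ} {z : ℂ} {t : ℝ} (ht : 0 ≤ t)
    (h : ∀ a ∈ s, t ≤ ‖z - a‖) :
    t ^ Multiset.card s ≤ ‖(s.map (fun a => z - a)).prod‖ := by
  induction s using Multiset.induction_on with
  | empty => simp
  | cons a s ih =>
    simp only [Multiset.map_cons, Multiset.prod_cons, norm_mul, Multiset.card_cons, pow_succ']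
    gcongr
    · exact h a (Multiset.mem_cons_self a s)
    · exact ih fun b hb => h b (Multiset.mem_cons_of_mem hb)

/-- The maximum principle for the cofactor of a product of linear factors. -/
theorem norm_cofactor_le {f g : ℂ → ℂ} {s : Multiset ℂ} {r ρ B : ℝ} (hrρ : r < ρ)
    (hr : 0 < r) (hg : Differentiable ℂ g) (hs : ∀ a ∈ s, ‖a‖ ≤ r)
    (hf : ∀ z, f z = (s.map (fun a => z - a)).prod * g z)
    (hB : ∀ z, ‖z‖ = ρ → ‖f z‖ ≤ B) {z : ℂ} (hz : ‖z‖ ≤ ρ) :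
    ‖g z‖ * (ρ - r) ^ Multiset.card s ≤ B := by
  have hpos : 0 < (ρ - r) ^ Multiset.card s := pow_pos (by linarith) _
  rw [← le_div_iff₀ hpos]
  refine Complex.norm_le_of_forall_mem_frontier_norm_le (U := Metric.ball 0 ρ)
    Metric.isBounded_ball hg.diffContOnCl (fun w hw => ?_) ?_
  · rw [frontier_ball _ (by linarith), mem_sphere_zero_iff_norm] at hw
    rw [le_div_iff₀ hpos]
    have h1 : (ρ - r) ^ Multiset.card s ≤ ‖(s.map (fun a => w - a)).prod‖ := by
      refine le_norm_prod_sub (by linarith) fun a ha => ?_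
      have := norm_sub_norm_le w a
      have := hs a ha
      linarith
    have h2 := hB w hw
    rw [hf w, norm_mul] at h2
    calc ‖g w‖ * (ρ - r) ^ Multiset.card s
        ≤ ‖g w‖ * ‖(s.map (fun a => w - a)).prod‖ := by gcongr
      _ ≤ B := by rwa [mul_comm]
  · rw [closure_ball _ (by linarith), mem_closedBall_zero_iff]
    exact hz

/-- Splitting off the zeros in a disc; the number of zeros is controlled by the growth. -/
theorem exists_zero_free_cofactor {f : ℂ → ℂ} {r B c : ℝ} (hf : Differentiable ℂ f) (hr : 0 < r)
    (hc : 0 < c) (hf0 : c ≤ ‖f 0‖) (hB : ∀ z, ‖z‖ = (1 + Real.exp 1) * r → ‖f z‖ ≤ B) :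
    ∃ (s : Multiset ℂ) (g : ℂ → ℂ), Differentiable ℂ g ∧
      (∀ z, f z = (s.map (fun a => z - a)).prod * g z) ∧
      (∀ z, ‖z‖ ≤ r → g z ≠ 0) ∧ (Multiset.card s : ℝ) ≤ Real.log (B / c) ∧
      c ≤ r ^ Multiset.card s * ‖g 0‖ ∧
      ∀ z, ‖z‖ ≤ r → ‖g z‖ ≤ ‖g 0‖ * (B / c) := by
  have he : 0 < Real.exp 1 := Real.exp_pos 1
  have key : ∀ (s : Multiset ℂ) (g : ℂ → ℂ), Differentiable ℂ g → (∀ a ∈ s, ‖a‖ ≤ r) →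
      (∀ z, f z = (s.map (fun a => z - a)).prod * g z) →
      c ≤ r ^ Multiset.card s * ‖g 0‖ ∧
      ∀ z, ‖z‖ ≤ r → ‖g z‖ * (Real.exp 1 * r) ^ Multiset.card s ≤ B := by
    intro s g hg hs hfg
    constructor
    · refine hf0.trans ?_
      rw [hfg 0, norm_mul]
      gcongr
      exact norm_prod_sub_le fun a ha => by simpa using hs a ha
    · intro z hz
      have := norm_cofactor_le (r := r) (ρ := (1 + Real.exp 1) * r) (by nlinarith) hr hg hs hfg hB
        (z := z) (by nlinarith)
      rwa [show (1 + Real.exp 1) * r - r = Real.exp 1 * r by ring] at this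
  -- On the circle of radius `(1 + e) r` each factor is at least `e * r`, while at the origin it is
  -- at most `r`. Every zero thus costs a factor `e`, and the count is a plain logarithm.
  have card_le : ∀ (s : Multiset ℂ) (g : ℂ → ℂ), Differentiable ℂ g → (∀ a ∈ s, ‖a‖ ≤ r) →
      (∀ z, f z = (s.map (fun a => z - a)).prod * g z) →
      (Multiset.card s : ℝ) ≤ Real.log (B / c) := by
    intro s g hg hs hfg
    obtain ⟨h1, h2⟩ := key s g hg hs hfg
    have h3 := h2 0 (by simpa using hr.le)
    have h4 : c * Real.exp 1 ^ Multiset.card s ≤ B := by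
      calc c * Real.exp 1 ^ Multiset.card s
          ≤ (r ^ Multiset.card s * ‖g 0‖) * Real.exp 1 ^ Multiset.card s := by gcongr
        _ = ‖g 0‖ * (Real.exp 1 * r) ^ Multiset.card s := by rw [mul_pow]; ring
        _ ≤ B := h3
    have hBpos : 0 < B := lt_of_lt_of_le (by positivity) h4
    rw [Real.le_log_iff_exp_le (by positivity), le_div_iff₀ hc, mul_comm]
    simpa [← Real.exp_nat_mul] using h4
  by_contra hcon
  -- If no cofactor were zero-free, zeros could be divided out indefinitely by `dslope`, against
  -- `card_le`.
  have step : ∀ n : ℕ, ∃ (s : Multiset ℂ) (g : ℂ → ℂ), Multiset.card s = n ∧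
      Differentiable ℂ g ∧ (∀ a ∈ s, ‖a‖ ≤ r) ∧
      (∀ z, f z = (s.map (fun a => z - a)).prod * g z) := by
    intro n
    induction n with
    | zero => exact ⟨0, f, by simp, hf, by simp, by simp⟩
    | succ n ih =>
      obtain ⟨s, g, hcard, hg, hs, hfg⟩ := ih
      by_cases hz : ∀ z, ‖z‖ ≤ r → g z ≠ 0
      · exfalso
        obtain ⟨h1, h2⟩ := key s g hg hs hfg
        refine hcon ⟨s, g, hg, hfg, hz, card_le s g hg hs hfg, h1, fun z hzr => ?_⟩
        have h3 := h2 z hzr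
        have h5 : ‖g z‖ * r ^ Multiset.card s ≤ B := by
          refine le_trans ?_ h3
          gcongr
          have : 1 ≤ Real.exp 1 := Real.one_le_exp zero_le_one
          nlinarith
        rw [← mul_div_assoc, le_div_iff₀ hc]
        calc ‖g z‖ * c ≤ ‖g z‖ * (r ^ Multiset.card s * ‖g 0‖) := by gcongr
          _ = ‖g 0‖ * (‖g z‖ * r ^ Multiset.card s) := by ring
          _ ≤ ‖g 0‖ * B := by gcongr
      · push Not at hz
        obtain ⟨a, har, hga⟩ := hz
        refine ⟨a ::ₘ s, dslope g a, by simp [hcard], ?_, ?_, ?_⟩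
        · rw [← differentiableOn_univ]
          exact (Complex.differentiableOn_dslope univ_mem).2 hg.differentiableOn
        · intro b hb
          rcases Multiset.mem_cons.1 hb with rfl | hb
          · exact har
          · exact hs b hb
        · intro z
          have : (z - a) * dslope g a z = g z := by
            have := sub_smul_dslope g a z
            simpa [hga] using this
          rw [hfg z, ← this, Multiset.map_cons, Multiset.prod_cons]
          ring
  obtain ⟨n, hn⟩ := exists_nat_gt (Real.log (B / c))
  obtain ⟨s, g, hcard, hg, hs, hfg⟩ := step n
  have := card_le s g hg hs hfg
  rw [hcard] at this
  linarith

/-! ### Monic polynomials on sets of positive measure -/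

theorem integrableOn_log_abs_sub {E : Set ℝ} {K : ℝ} (hEK : E ⊆ Set.Icc (-K) K) (b : ℝ) :
    IntegrableOn (fun x => Real.log |x - b|) E := by
  rcases le_or_gt (-K) K with hK | hK
  · refine IntegrableOn.mono_set ?_ hEK
    rw [← intervalIntegrable_iff_integrableOn_Icc_of_le hK]
    simp only [Real.log_abs]
    simpa using
      (intervalIntegral.intervalIntegrable_log' (a := -K - b) (b := K - b)).comp_sub_right b
  · rw [Set.Icc_eq_empty (not_le.2 hK)] at hEK
    rw [Set.subset_empty_iff.1 hEK]
    exact integrableOn_empty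

/-- Only points within `m` of `b` fall below `log m`. The total deficit `ψ` over the whole interval
`(b - m, b + m]` is exactly `2m`, whatever the shape of `E`. -/
theorem setIntegral_log_abs_sub_ge {E : Set ℝ} {K : ℝ} (hEK : E ⊆ Set.Icc (-K) K)
    (hm : 0 < volume.real E) (b : ℝ) :
    volume.real E * (Real.log (volume.real E) - 2) ≤ ∫ x in E, Real.log |x - b| := by
  set m := volume.real E with hmdef
  have hEfin : volume E ≠ ⊤ :=
    ((measure_mono hEK).trans_lt (by simp)).ne
  have hI : IntervalIntegrable (fun x => Real.log |x - b|) volume (b - m) (b + m) := by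
    simp only [Real.log_abs]
    rw [sub_eq_neg_add, add_comm b m]
    simpa using (intervalIntegral.intervalIntegrable_log' (a := -m) (b := m)).comp_sub_right b
  have hIψ : IntervalIntegrable (fun x => Real.log m - Real.log |x - b|) volume (b - m) (b + m) :=
    intervalIntegrable_const.sub hI
  set ψ : ℝ → ℝ := (Set.Ioc (b - m) (b + m)).indicator (fun x => Real.log m - Real.log |x - b|)
    with hψ
  have hle : b - m ≤ b + m := by linarith
  have hψint : Integrable ψ := by
    rw [hψ, integrable_indicator_iff measurableSet_Ioc]
    exact (intervalIntegrable_iff_integrableOn_Ioc_of_le hle).1 hIψ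
  have hψval : ∫ x, ψ x = 2 * m := by
    rw [hψ, integral_indicator measurableSet_Ioc, ← intervalIntegral.integral_of_le hle,
      intervalIntegral.integral_sub intervalIntegrable_const hI]
    have : ∫ x in (b - m)..(b + m), Real.log |x - b| = ∫ x in (-m)..m, Real.log x := by
      simp only [Real.log_abs]
      rw [intervalIntegral.integral_comp_sub_right (fun x => Real.log x) b]
      congr 1 <;> ring
    rw [this, integral_log, intervalIntegral.integral_const, Real.log_neg_eq_log]
    simp only [smul_eq_mul]
    ring
  have hψ0 : 0 ≤ᵐ[volume] ψ := by
    have : ∀ᵐ x : ℝ ∂volume, x ≠ b := by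
      simp [ae_iff]
    filter_upwards [this] with x hx
    rw [hψ]
    refine Set.indicator_apply_nonneg fun hxm => ?_
    have h1 : |x - b| ≤ m := abs_le.2 ⟨by linarith [hxm.1], by linarith [hxm.2]⟩
    have := Real.log_le_log (abs_pos.2 (sub_ne_zero.2 hx)) h1
    linarith
  have hpt : ∀ x, Real.log m - ψ x ≤ Real.log |x - b| := by
    intro x
    by_cases hx : x ∈ Set.Ioc (b - m) (b + m)
    · rw [hψ, Set.indicator_of_mem hx]
      linarith
    · rw [hψ, Set.indicator_of_notMem hx, sub_zero]
      refine Real.log_le_log hm ?_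
      by_contra hlt
      rw [not_le, abs_lt] at hlt
      exact hx ⟨by linarith [hlt.1], by linarith [hlt.2]⟩
  have hconst : IntegrableOn (fun _ : ℝ => Real.log m) E := integrableOn_const hEfin
  calc m * (Real.log m - 2) = m * Real.log m - ∫ x, ψ x := by rw [hψval]; ring
    _ ≤ m * Real.log m - ∫ x in E, ψ x := by
        have := setIntegral_le_integral (s := E) hψint hψ0
        linarith
    _ = ∫ x in E, (Real.log m - ψ x) := by
        rw [integral_sub hconst hψint.integrableOn, setIntegral_const, smul_eq_mul]
    _ ≤ ∫ x in E, Real.log |x - b| :=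
        setIntegral_mono (hconst.sub hψint.integrableOn) (integrableOn_log_abs_sub hEK b) hpt

theorem integrableOn_sum_log_and_ge {E : Set ℝ} {K : ℝ} (hEK : E ⊆ Set.Icc (-K) K)
    (hm : 0 < volume.real E) (s : Multiset ℂ) :
    IntegrableOn (fun x => (s.map (fun a => Real.log |x - a.re|)).sum) E ∧
    Multiset.card s * (volume.real E * (Real.log (volume.real E) - 2)) ≤
      ∫ x in E, (s.map (fun a => Real.log |x - a.re|)).sum := by
  induction s using Multiset.induction_on with
  | empty => simp
  | cons a s ih =>
    have h1 := integrableOn_log_abs_sub hEK a.re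
    have h2 := setIntegral_log_abs_sub_ge hEK hm a.re
    simp only [Multiset.map_cons, Multiset.sum_cons, Multiset.card_cons, Nat.cast_succ]
    refine ⟨h1.add ih.1, ?_⟩
    rw [integral_add h1 ih.1]
    linarith [ih.2]

/-- On any set of positive measure a monic polynomial is somewhere not too small. -/
theorem exists_mem_prod_sub_ge {E : Set ℝ} {K : ℝ} (hEK : E ⊆ Set.Icc (-K) K)
    (hm : 0 < volume.real E) (s : Multiset ℂ) :
    ∃ x ∈ E, Real.exp (Multiset.card s * (Real.log (volume.real E) - 2)) ≤
      ‖(s.map (fun a => (x : ℂ) - a)).prod‖ := by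
  classical
  -- The real parts of the zeros must be avoided: there `Real.log 0 = 0`, so exponentiating would
  -- not return `|x - a.re|`.
  set N : Set ℝ := ((s.map Complex.re).toFinset : Set ℝ) with hN
  have hN0 : volume N = 0 := (Finset.finite_toSet _).measure_zero _
  obtain ⟨hint, hge⟩ := integrableOn_sum_log_and_ge hEK hm s
  have hE0 : volume E ≠ 0 := fun h => by simp [Measure.real, h] at hm
  have hEfin : volume E ≠ ⊤ := ((measure_mono hEK).trans_lt (by simp)).ne
  have hEN : volume (E \ N) = volume E := measure_sdiff_null hN0
  obtain ⟨x, hx, hxle⟩ := exists_setAverage_le (s := E \ N) (by rwa [hEN]) (by rwa [hEN])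
    (hint.mono_set Set.sdiff_subset)
  refine ⟨x, hx.1, ?_⟩
  have hae : (E \ N : Set ℝ) =ᵐ[volume] E := sdiff_null_ae_eq_self hN0
  rw [setAverage_eq, setIntegral_congr_set hae, measureReal_congr hae, smul_eq_mul,
    inv_mul_le_iff₀ hm] at hxle
  have h1 : Multiset.card s * (Real.log (volume.real E) - 2) ≤
      (s.map (fun a => Real.log |x - a.re|)).sum := by
    refine le_of_mul_le_mul_left ?_ hm
    linarith
  refine (Real.exp_le_exp.2 h1).trans ?_
  have hxN : ∀ a ∈ s, x ≠ a.re := by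
    intro a ha hxa
    refine hx.2 ?_
    rw [hN, Finset.mem_coe, Multiset.mem_toFinset, hxa]
    exact Multiset.mem_map_of_mem _ ha
  clear * - hxN
  induction s using Multiset.induction_on with
  | empty => simp
  | cons a s ih =>
    simp only [Multiset.map_cons, Multiset.sum_cons, Multiset.prod_cons, norm_mul, Real.exp_add]
    refine mul_le_mul ?_ (ih fun b hb => hxN b (Multiset.mem_cons_of_mem hb))
      (Real.exp_nonneg _) (norm_nonneg _)
    rw [Real.exp_log (abs_pos.2 (sub_ne_zero.2 (hxN a (Multiset.mem_cons_self a s))))]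
    simpa using Complex.abs_re_le_norm ((x : ℂ) - a)

/-! ### The Cartan-type estimate -/

/-- A quantitative bound for the size of the real small-value set of an entire function: if
`‖f‖ ≤ δ` on a set of measure `m`, then `δ` cannot be too small. -/
theorem log_ge_of_norm_le_on {f : ℂ → ℂ} {r B c δ : ℝ} {E : Set ℝ} (hf : Differentiable ℂ f)
    (hr : 0 < r) (hc : 0 < c) (hcB : c < B) (hf0 : c ≤ ‖f 0‖)
    (hB : ∀ z, ‖z‖ = (1 + Real.exp 1) * r → ‖f z‖ ≤ B)
    (hEr : E ⊆ Set.Icc (-(4 / 5 * r)) (4 / 5 * r))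
    (hm : 0 < volume.real E) (hδ : ∀ x ∈ E, ‖f x‖ ≤ δ) :
    Real.log c - Real.log (B / c) * (10 + Real.log (r / volume.real E)) ≤ Real.log δ := by
  obtain ⟨s, g, hg, hfg, hz, hn, hc0, hgle⟩ := exists_zero_free_cofactor hf hr hc hf0 hB
  obtain ⟨x, hxE, hx⟩ := exists_mem_prod_sub_ge hEr hm s
  set n : ℝ := (Multiset.card s : ℝ) with hndef
  set m := volume.real E with hmdef
  set Q := Real.log (B / c) with hQdef
  have hBc : 0 < B / c := div_pos (hc.trans hcB) hc
  have hQ : 0 < Q := Real.log_pos ((one_lt_div hc).2 hcB)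
  have hxr : ‖(x : ℂ)‖ ≤ 4 / 5 * r := by
    rw [Complex.norm_real, Real.norm_eq_abs]
    exact abs_le.2 (hEr hxE)
  have hH := log_norm_ge_of_ne_zero_on_ball hr hQ hg.differentiableOn
    (fun z hzr => hz z (by simpa using (mem_ball_zero_iff.1 hzr).le))
    (fun z hzr => by
      rw [hQdef, Real.exp_log hBc]
      exact hgle z (mem_ball_zero_iff.1 hzr).le) hxr
  have hg0 : Real.exp (Real.log c - n * Real.log r) ≤ ‖g 0‖ := by
    rw [Real.exp_sub, Real.exp_log hc, hndef, Real.exp_nat_mul, Real.exp_log hr,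
      div_le_iff₀ (by positivity), mul_comm]
    exact hc0
  have hmr : m ≤ 8 / 5 * r := by
    have : volume.real E ≤ volume.real (Set.Icc (-(4 / 5 * r)) (4 / 5 * r)) :=
      measureReal_mono hEr (by simp)
    rw [Real.volume_real_Icc_of_le (by linarith)] at this
    linarith
  have hlow : Real.exp (n * (Real.log m - 2) + (Real.log c - n * Real.log r) + -(8 * Q)) ≤
      ‖f x‖ := by
    rw [hfg, norm_mul, Real.exp_add, Real.exp_add, mul_assoc]
    gcongr
    refine le_trans ?_ hH
    gcongr
  have hfin := Real.log_le_log (Real.exp_pos _) (hlow.trans (hδ x hxE))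
  rw [Real.log_exp] at hfin
  rw [Real.log_div hr.ne' hm.ne']
  -- This sign allows the number of zeros to be replaced by its upper bound `Q`. The 10 in the
  -- conclusion is this 2 plus the 8 from Harnack.
  have hlog : 0 ≤ 2 + Real.log r - Real.log m := by
    have h1 : Real.log m ≤ Real.log (8 / 5 * r) := Real.log_le_log hm hmr
    rw [Real.log_mul (by norm_num) hr.ne'] at h1
    have h2 : Real.log (8 / 5) ≤ 8 / 5 - 1 := Real.log_le_sub_one_of_pos (by norm_num)
    linarith
  nlinarith [mul_le_mul_of_nonneg_right hn hlog]

/-! ### The Fourier–Laplace transform and injectivity -/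

/-- The Fourier–Laplace transform `∫ e^{-izt} φ(t) dt` at a complex argument. -/
noncomputable def fourierLaplace (φ : ℝ → ℂ) (z : ℂ) : ℂ :=
  ∫ t : ℝ, Complex.exp (-(Complex.I * z * (t : ℂ))) * φ t

theorem fourierLaplace_ofReal (φ : ℝ → ℂ) (x : ℝ) :
    fourierLaplace φ (x : ℂ) = fourierHat φ x := rfl

theorem norm_exp_neg_I_mul_le {z : ℂ} {t s : ℝ} (ht : |t| ≤ s) :
    ‖Complex.exp (-(Complex.I * z * (t : ℂ)))‖ ≤ Real.exp (s * ‖z‖) := by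
  rw [Complex.norm_exp]
  refine Real.exp_le_exp.2 ?_
  calc (-(Complex.I * z * (t : ℂ))).re ≤ ‖-(Complex.I * z * (t : ℂ))‖ := Complex.re_le_norm _
    _ = |t| * ‖z‖ := by simp [mul_comm]
    _ ≤ s * ‖z‖ := by gcongr

theorem norm_exp_neg_I_mul_ofReal (x t : ℝ) :
    ‖Complex.exp (-(Complex.I * (x : ℂ) * (t : ℂ)))‖ = 1 := by
  rw [Complex.norm_exp]
  simp

theorem integrable_exp_mul_ofReal {φ : ℝ → ℂ} (hφ : Integrable φ) (x : ℝ) :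
    Integrable (fun t : ℝ => Complex.exp (-(Complex.I * (x : ℂ) * (t : ℂ))) * φ t) := by
  refine hφ.bdd_mul (c := 1) ?_ ?_
  · exact (by fun_prop : Continuous fun t : ℝ =>
      Complex.exp (-(Complex.I * (x : ℂ) * (t : ℂ)))).aestronglyMeasurable
  · filter_upwards with t
    rw [norm_exp_neg_I_mul_ofReal]

theorem norm_fourierHat_le (φ : ℝ → ℂ) (x : ℝ) : ‖fourierHat φ x‖ ≤ ∫ t, ‖φ t‖ := by
  refine (norm_integral_le_integral_norm _).trans_eq ?_
  simp only [norm_mul, norm_exp_neg_I_mul_ofReal, one_mul]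

theorem fourierHat_sub {φ ψ : ℝ → ℂ} (hφ : Integrable φ) (hψ : Integrable ψ) (x : ℝ) :
    fourierHat φ x - fourierHat ψ x = fourierHat (fun t => φ t - ψ t) x := by
  unfold fourierHat
  rw [← integral_sub (integrable_exp_mul_ofReal hφ x) (integrable_exp_mul_ofReal hψ x)]
  simp only [mul_sub]

theorem norm_fourierLaplace_le {φ : ℝ → ℂ} {s : ℝ} (hφ : Integrable φ)
    (hs : ∀ t, s < |t| → φ t = 0) (z : ℂ) :
    ‖fourierLaplace φ z‖ ≤ (∫ t, ‖φ t‖) * Real.exp (s * ‖z‖) := by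
  refine (norm_integral_le_of_norm_le (hφ.norm.mul_const (Real.exp (s * ‖z‖))) ?_).trans_eq
    (integral_mul_const _ _)
  filter_upwards with t
  by_cases ht : s < |t|
  · simp [hs t ht]
  · rw [norm_mul, mul_comm]
    gcongr
    exact norm_exp_neg_I_mul_le (not_lt.1 ht)

theorem differentiable_fourierLaplace {φ : ℝ → ℂ} {s : ℝ} (hφ : Integrable φ) (hs0 : 0 ≤ s)
    (hs : ∀ t, s < |t| → φ t = 0) : Differentiable ℂ (fourierLaplace φ) := by
  intro z₀
  have hmeas : ∀ z : ℂ, AEStronglyMeasurable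
      (fun t : ℝ => Complex.exp (-(Complex.I * z * (t : ℂ))) * φ t) volume := fun z =>
    (by fun_prop : Continuous fun t : ℝ =>
      Complex.exp (-(Complex.I * z * (t : ℂ)))).aestronglyMeasurable.mul hφ.aestronglyMeasurable
  refine (hasDerivAt_integral_of_dominated_loc_of_deriv_le (μ := volume)
    (F := fun (z : ℂ) (t : ℝ) => Complex.exp (-(Complex.I * z * (t : ℂ))) * φ t)
    (F' := fun (z : ℂ) (t : ℝ) =>
      Complex.exp (-(Complex.I * z * (t : ℂ))) * (-(Complex.I * t)) * φ t)
    (bound := fun t => Real.exp (s * (‖z₀‖ + 1)) * s * ‖φ t‖)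
    (Metric.ball_mem_nhds z₀ one_pos) (Eventually.of_forall hmeas) ?_ ?_ ?_ ?_ ?_).2.differentiableAt
  · refine (hφ.norm.mul_const (Real.exp (s * ‖z₀‖))).mono' (hmeas z₀) ?_
    filter_upwards with t
    by_cases ht : s < |t|
    · simp [hs t ht]
    · rw [norm_mul, mul_comm]
      gcongr
      exact norm_exp_neg_I_mul_le (not_lt.1 ht)
  · exact (by fun_prop : Continuous fun t : ℝ =>
      Complex.exp (-(Complex.I * z₀ * (t : ℂ))) * (-(Complex.I * t))).aestronglyMeasurable.mul
      hφ.aestronglyMeasurable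
  · filter_upwards with t z hz
    by_cases ht : s < |t|
    · simp [hs t ht]
    · rw [not_lt] at ht
      have hz' : ‖z‖ ≤ ‖z₀‖ + 1 := by
        have := norm_sub_norm_le z z₀
        rw [Metric.mem_ball, dist_eq_norm] at hz
        linarith
      rw [norm_mul, norm_mul]
      gcongr
      · exact (norm_exp_neg_I_mul_le ht).trans (by gcongr)
      · simpa using ht
  · exact hφ.norm.const_mul _
  · filter_upwards with t z _
    have h1 : HasDerivAt (fun w : ℂ => -(Complex.I * w * (t : ℂ))) (-(Complex.I * t)) z := by
      simpa using! (((hasDerivAt_id z).const_mul Complex.I).mul_const (t : ℂ)).neg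
    exact h1.cexp.mul_const (φ t)

/-- Injectivity of the Fourier transform on `L¹`. -/
theorem exists_fourierHat_ne_zero {φ : ℝ → ℂ} (hφ : Integrable φ) (hφ0 : ¬ φ =ᵐ[volume] 0) :
    ∃ x, fourierHat φ x ≠ 0 := by
  by_contra! hzero
  refine hφ0 ?_
  have hF : ∀ x : ℝ, FourierTransform.fourier φ x = 0 := by
    intro x
    rw [Real.fourier_eq', ← hzero (2 * Real.pi * x)]
    unfold fourierHat
    refine integral_congr_ae (Eventually.of_forall fun t => ?_)
    simp only [smul_eq_mul]
    congr 2
    simp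
    ring
  refine ae_eq_zero_of_integral_contDiff_smul_eq_zero hφ.locallyIntegrable ?_
  -- Each test function is the transform of a Schwartz function `H`, so moving the transform across
  -- gives `∫ φ g = ∫ φ̂ H = 0`.
  intro g hg hgc
  have hg₁ : HasCompactSupport (Complex.ofRealCLM ∘ g) := hgc.comp_left rfl
  have hg₂ : ContDiff ℝ (⊤ : ℕ∞) (Complex.ofRealCLM ∘ g) := by fun_prop
  set G : SchwartzMap ℝ ℂ := hg₁.toSchwartzMap hg₂ with hG
  set H : SchwartzMap ℝ ℂ := FourierTransformInv.fourierInv G with hH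
  have hHG : FourierTransform.fourier (H : ℝ → ℂ) = G := by
    rw [← SchwartzMap.fourier_coe, hH, FourierTransform.fourier_fourierInv_eq]
  have hflip := VectorFourier.integral_fourierIntegral_smul_eq_flip (L := innerₗ ℝ)
    (μ := volume) (ν := volume) Real.continuous_fourierChar continuous_inner hφ
    (H.integrable (μ := volume))
  have hflip' : ∫ ξ, FourierTransform.fourier φ ξ • H ξ =
      ∫ x, φ x • FourierTransform.fourier (H : ℝ → ℂ) x := by
    simpa using! hflip
  rw [hHG] at hflip'
  simp only [hF, zero_smul, integral_zero] at hflip'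
  rw [hflip']
  refine integral_congr_ae (Eventually.of_forall fun x => ?_)
  have : G x = (g x : ℂ) := rfl
  simp [this, mul_comm]

/-! ### Truncation and the size of the truncation radius -/

theorem smallValueSet_subset (φ : ℝ → ℂ) (δ R : ℝ) :
    smallValueSet φ δ R ⊆ Set.Icc (-R) R := fun _ hx => abs_le.1 hx.2

theorem exp_neg_tailExponent (φ : ℝ → ℂ) (s : ℝ) :
    EReal.exp (-tailExponent φ s) = ∫⁻ t in {t : ℝ | s ≤ |t|}, ‖φ t‖ₑ := by
  simp [tailExponent]

theorem measurableSet_le_abs (s : ℝ) : MeasurableSet {t : ℝ | s ≤ |t|} :=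
  measurableSet_le measurable_const continuous_abs.measurable

theorem norm_fourierHat_sub_truncation_le {φ : ℝ → ℂ} (hφ : Integrable φ) {s ε : ℝ} (hε : 0 ≤ ε)
    (hs : EReal.exp (-tailExponent φ s) ≤ ENNReal.ofReal ε) (x : ℝ) :
    ‖fourierHat φ x - fourierHat ({t : ℝ | s ≤ |t|}ᶜ.indicator φ) x‖ ≤ ε := by
  have hS := measurableSet_le_abs s
  rw [fourierHat_sub hφ (hφ.indicator hS.compl)]
  have h1 : (fun t => φ t - {t : ℝ | s ≤ |t|}ᶜ.indicator φ t) = {t : ℝ | s ≤ |t|}.indicator φ := by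
    funext t
    rw [sub_eq_iff_eq_add, Set.indicator_self_add_compl_apply]
  rw [h1]
  refine (norm_fourierHat_le _ x).trans ?_
  rw [integral_norm_eq_lintegral_enorm (hφ.indicator hS).aestronglyMeasurable]
  refine ENNReal.toReal_le_of_le_ofReal hε ?_
  rw [exp_neg_tailExponent, ← lintegral_indicator hS] at hs
  refine le_trans (le_of_eq ?_) hs
  refine lintegral_congr fun t => ?_
  rw [enorm_indicator_eq_indicator_enorm]

/-- Superlinear growth of the tail exponent makes the truncation radius `o(log (1 / ε))`. -/
theorem truncationRadius_le_of_tendsto {φ : ℝ → ℂ}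
    (hp : Tendsto (fun s : ℝ => tailExponent φ s / (s : EReal)) atTop (𝓝 ⊤)) {η : ℝ}
    (hη : 0 < η) : ∃ S : ℝ, ∀ ε : ℝ, 0 < ε → ε < 1 →
      {s : ℝ | 0 < s ∧ EReal.exp (-tailExponent φ s) ≤ ENNReal.ofReal ε}.Nonempty ∧
      truncationRadius φ ε ≤ S + η * (-Real.log ε) := by
  have h1 := (hp.eventually_const_lt (EReal.coe_lt_top η⁻¹)).and (eventually_ge_atTop (1 : ℝ))
  obtain ⟨S, hS⟩ := eventually_atTop.1 h1
  refine ⟨max S 1, fun ε hε hε1 => ?_⟩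
  have hlog : 0 < -Real.log ε := neg_pos.2 (Real.log_neg hε hε1)
  -- Beyond `S` the exponent satisfies `p(s) > s / η`, which is at least `-log ε` for this `s`.
  set s := max S 1 + η * (-Real.log ε) with hsdef
  have hpos : 0 < η * (-Real.log ε) := mul_pos hη hlog
  have hs1 : 1 ≤ s := by linarith [le_max_right S 1]
  have hmem : s ∈ {s : ℝ | 0 < s ∧ EReal.exp (-tailExponent φ s) ≤ ENNReal.ofReal ε} := by
    refine ⟨by linarith, ?_⟩
    have h2 := (hS s (by linarith [le_max_left S 1])).1
    rw [EReal.lt_div_iff (by exact_mod_cast (by linarith : 0 < s)) (EReal.coe_ne_top s)] at h2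
    have h3 : ((-Real.log ε : ℝ) : EReal) ≤ tailExponent φ s := by
      refine le_trans ?_ h2.le
      rw [← EReal.coe_mul, EReal.coe_le_coe_iff, ← div_eq_inv_mul, le_div_iff₀ hη]
      linarith [le_max_right S 1]
    have h4 : -tailExponent φ s ≤ ((Real.log ε : ℝ) : EReal) := by
      rw [EReal.neg_le]
      simpa using h3
    calc EReal.exp (-tailExponent φ s) ≤ EReal.exp ((Real.log ε : ℝ) : EReal) :=
          EReal.exp_monotone h4
      _ = ENNReal.ofReal ε := by rw [EReal.exp_coe, Real.exp_log hε]
  exact ⟨⟨s, hmem⟩, csInf_le ⟨0, fun _ hs => hs.1.le⟩ hmem⟩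

/-- Otherwise `φ` vanishes a.e. on every `{|t| ≥ 1 / (n + 1)}`, hence a.e. This keeps the truncation
radius away from zero, so later thresholds on `R` do not depend on `ε`. -/
theorem exists_tail_pos {φ : ℝ → ℂ} (hφ : Integrable φ) (hφ0 : ¬ φ =ᵐ[volume] 0) :
    ∃ s : ℝ, 0 < s ∧ 0 < ∫⁻ t in {t : ℝ | s ≤ |t|}, ‖φ t‖ₑ := by
  by_contra! hzero
  refine hφ0 ?_
  have h1 : ∀ n : ℕ, ∀ᵐ t : ℝ, 1 / ((n : ℝ) + 1) ≤ |t| → φ t = 0 := by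
    intro n
    have h2 := nonpos_iff_eq_zero.1 (hzero (1 / ((n : ℝ) + 1)) (by positivity))
    rw [lintegral_eq_zero_iff' hφ.aestronglyMeasurable.enorm.restrict,
      EventuallyEq, ae_restrict_iff' (measurableSet_le_abs _)] at h2
    filter_upwards [h2] with t ht hle
    simpa using ht hle
  have h0 : ∀ᵐ t : ℝ, t ≠ 0 := by simp [ae_iff]
  filter_upwards [ae_all_iff.2 h1, h0] with t ht ht0
  obtain ⟨n, hn⟩ := exists_nat_one_div_lt (abs_pos.2 ht0)
  exact ht n hn.le

/-- For small `ε` the truncation radius stays away from zero. -/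
theorem exists_le_truncationRadius {φ : ℝ → ℂ} (hφ : Integrable φ) (hφ0 : ¬ φ =ᵐ[volume] 0) :
    ∃ s₁ : ℝ, 0 < s₁ ∧ ∃ ε₁ : ℝ, 0 < ε₁ ∧ ∀ ε : ℝ, ε < ε₁ →
      {s : ℝ | 0 < s ∧ EReal.exp (-tailExponent φ s) ≤ ENNReal.ofReal ε}.Nonempty →
      s₁ ≤ truncationRadius φ ε := by
  obtain ⟨s₁, hs₁, hpos⟩ := exists_tail_pos hφ hφ0
  have hfin : ∫⁻ t in {t : ℝ | s₁ ≤ |t|}, ‖φ t‖ₑ ≠ ⊤ :=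
    ((setLIntegral_le_lintegral _ _).trans_lt hφ.hasFiniteIntegral).ne
  refine ⟨s₁, hs₁, _, ENNReal.toReal_pos hpos.ne' hfin, fun ε hε hne => le_csInf hne ?_⟩
  rintro s ⟨hs, hle⟩
  by_contra! hlt
  rw [exp_neg_tailExponent] at hle
  have hmono : ∫⁻ t in {t : ℝ | s₁ ≤ |t|}, ‖φ t‖ₑ ≤ ∫⁻ t in {t : ℝ | s ≤ |t|}, ‖φ t‖ₑ :=
    lintegral_mono_set fun t ht => hlt.le.trans ht
  have hlt' := (ENNReal.ofReal_lt_ofReal_iff (ENNReal.toReal_pos hpos.ne' hfin)).2 hε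
  rw [ENNReal.ofReal_toReal hfin] at hlt'
  exact absurd (hmono.trans hle) (not_le.2 hlt')

/-! ### Calibrating the constants for large radii -/

theorem log_fifteen_mul_exp_pos : 0 < Real.log (15 * Real.exp 1 ^ 3) :=
  Real.log_pos (by linarith [one_le_pow₀ (Real.one_le_exp (zero_le_one (α := ℝ))) (n := 3)])

/-- Entire functions of exponential type that are not small at a fixed real point `x₀` cannot be
very small on a real set of measure larger than `R ^ (-q + 1 / 2)` in `[-R, R]`. -/
theorem eventually_lt_log_of_norm_le_on (x₀ : ℝ) {q A c s₁ : ℝ} (hq : 1 / 2 < q) (hc : 0 < c)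
    (hcA : c < A) (hs₁ : 0 < s₁) :
    ∀ᶠ R : ℝ in atTop, ∀ s s' : ℝ, s₁ ≤ s → 0 ≤ s' → s' ≤ 11 / 10 * s →
      ∀ F : ℂ → ℂ, Differentiable ℂ F → c ≤ ‖F x₀‖ →
      (∀ z, ‖F z‖ ≤ A * Real.exp (s' * ‖z‖)) →
      ∀ E : Set ℝ, E ⊆ Set.Icc (-R) R → R ^ (-q + 1 / 2) < volume.real E →
      ∀ δ : ℝ, (∀ x ∈ E, ‖F x‖ ≤ δ) →
      -(((q + 1 / 2) * Real.log R + Real.log (15 * Real.exp 1 ^ 3)) *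
        (Real.log A + 2 * Real.exp 1 * s * R)) < Real.log δ := by
  have hA : 0 < A := hc.trans hcA
  have hlin : ∀ a b : ℝ, 0 < b → ∀ᶠ R : ℝ in atTop, a ≤ b * R := fun a b hb =>
    (tendsto_id.const_mul_atTop hb).eventually_ge_atTop a
  -- In units of `s * R`, the equation supplies `5.4 * l` and the estimate costs `5.2 * (11 + l)`,
  -- plus 1 for `log c`. Hence `l > 291` is enough.
  have hlogev : ∀ᶠ R : ℝ in atTop, 300 ≤ (q + 1 / 2) * Real.log R :=
    (Real.tendsto_log_atTop.const_mul_atTop (by linarith)).eventually_ge_atTop 300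
  filter_upwards [hlogev, hlin |x₀| (1 / 1000) (by norm_num),
    hlin (Real.log (A / c)) (8 / 100 * s₁) (by positivity),
    hlin (-Real.log A) (3 / 100 * s₁) (by positivity), hlin (-Real.log c) s₁ hs₁,
    eventually_ge_atTop (1 : ℝ)] with R hl hx hAc hlogA hlogc hR1
  intro s s' hs hs'0 hs' F hF hFx hFle E hER hm δ hδ
  have hR : 0 < R := by linarith
  -- After translating `x₀` to the origin, `E` lies in `[-(R + |x₀|), R + |x₀|]`, which is `4/5` of
  -- this radius.
  set r : ℝ := 5 / 4 * (R + |x₀|) with hr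
  have hx0 := abs_nonneg x₀
  have hr0 : 0 < r := by positivity
  have hs0 : 0 < s := hs₁.trans_le hs
  have hP : 0 < s * R := mul_pos hs0 hR
  have hs₁P : s₁ * R ≤ s * R := by gcongr
  set B : ℝ := A * Real.exp (s' * (|x₀| + (1 + Real.exp 1) * r)) with hB
  have hcB : c < B := by
    refine hcA.trans_le ?_
    rw [hB]
    exact le_mul_of_one_le_right hA.le (Real.one_le_exp (by positivity))
  have hmpos : 0 < volume.real E := (Real.rpow_nonneg hR.le _).trans_lt hm
  set E' : Set ℝ := (fun x => x₀ + x) ⁻¹' E with hE'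
  have hE'm : volume.real E' = volume.real E := by
    simp only [Measure.real, hE', measure_preimage_add]
  have hmain := log_ge_of_norm_le_on (f := fun z => F (x₀ + z)) (r := r) (B := B) (c := c)
    (δ := δ) (E := E') (hF.comp (differentiable_id.const_add _)) hr0 hc hcB (by simpa using hFx)
    (fun z hz => by
      refine (hFle _).trans ?_
      rw [hB]
      gcongr
      refine (norm_add_le _ _).trans ?_
      rw [hz, Complex.norm_real, Real.norm_eq_abs])
    (fun x hx => by
      obtain ⟨h1, h2⟩ := hER hx
      rw [hr]
      constructor <;> linarith [neg_abs_le x₀, le_abs_self x₀])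
    (by rwa [hE'm])
    (fun x hx => by
      have := hδ (x₀ + x) hx
      push_cast at this
      exact this)
  rw [hE'm] at hmain
  have he1 := Real.exp_one_gt_d9
  have he2 := Real.exp_one_lt_d9
  have hrR : r ≤ 125125 / 100000 * R := by rw [hr]; linarith
  have hQ0 : 0 < Real.log (B / c) := Real.log_pos ((one_lt_div hc).2 hcB)
  have hQ : Real.log (B / c) ≤ 52 / 10 * (s * R) := by
    have h1 : Real.log (B / c) =
        Real.log (A / c) + s' * (|x₀| + (1 + Real.exp 1) * r) := by
      rw [hB, mul_div_right_comm, Real.log_mul (by positivity) (by positivity), Real.log_exp]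
    have h2 : |x₀| + (1 + Real.exp 1) * r ≤ 4654 / 1000 * R := by
      have : (1 + Real.exp 1) * r ≤ 3.7183 * (125125 / 100000 * R) := by
        gcongr
        linarith
      linarith
    have h3 : s' * (|x₀| + (1 + Real.exp 1) * r) ≤ 11 / 10 * s * (4654 / 1000 * R) := by
      gcongr
    rw [h1]
    linarith
  set l := (q + 1 / 2) * Real.log R with hldef
  -- The exponent `q + 1/2` arises here: `r / m` is at most a constant times `R / R ^ (-q + 1/2)`.
  have hlogm : 10 + Real.log (r / volume.real E) ≤ 11 + l := by
    rw [Real.log_div hr0.ne' hmpos.ne']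
    have h1 : Real.log r ≤ Real.log (125125 / 100000) + Real.log R := by
      rw [← Real.log_mul (by norm_num) hR.ne']
      exact Real.log_le_log hr0 hrR
    have h2 : Real.log (125125 / 100000) ≤ 125125 / 100000 - 1 :=
      Real.log_le_sub_one_of_pos (by norm_num)
    have h3 : (-q + 1 / 2) * Real.log R ≤ Real.log (volume.real E) := by
      rw [← Real.log_rpow hR]
      exact Real.log_le_log (Real.rpow_pos_of_pos hR _) hm.le
    rw [hldef]
    linarith
  have hprod : Real.log (B / c) * (10 + Real.log (r / volume.real E)) ≤
      52 / 10 * (s * R) * (11 + l) := by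
    calc _ ≤ Real.log (B / c) * (11 + l) := by gcongr
      _ ≤ _ := by gcongr
  have hK : 54 / 10 * (s * R) ≤ Real.log A + 2 * Real.exp 1 * s * R := by
    have : 2 * 2.718 * (s * R) ≤ 2 * Real.exp 1 * (s * R) := by
      gcongr
      linarith
    linarith
  have hL := log_fifteen_mul_exp_pos
  have hLK : l * (54 / 10 * (s * R)) ≤ (l + Real.log (15 * Real.exp 1 ^ 3)) *
      (Real.log A + 2 * Real.exp 1 * s * R) := by
    gcongr
    · linarith
  nlinarith [mul_pos hP (by linarith : 0 < l - 299)]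

/-! ### Solutions of the radius equation -/

theorem neg_log_rpow_add_self_ge {β ε : ℝ} (hε : 0 < ε) (hε1 : ε < 1) :
    min β 1 * (-Real.log ε) - Real.log 2 ≤ -Real.log (ε ^ β + ε) := by
  have h1 : ε ^ β ≤ ε ^ min β 1 :=
    Real.rpow_le_rpow_of_exponent_ge hε hε1.le (min_le_left _ _)
  have h2 : ε ≤ ε ^ min β 1 := by
    simpa using Real.rpow_le_rpow_of_exponent_ge hε hε1.le (min_le_right β 1)
  have h3 : Real.log (ε ^ β + ε) ≤ Real.log (2 * ε ^ min β 1) :=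
    Real.log_le_log (add_pos (Real.rpow_pos_of_pos hε _) hε) (by linarith)
  rw [Real.log_mul two_ne_zero (Real.rpow_pos_of_pos hε _).ne', Real.log_rpow hε] at h3
  linarith

/-- The right side of the radius equation dominates every multiple of the truncation radius. -/
theorem eventually_mul_truncationRadius_lt {φ : ℝ → ℂ}
    (hp : Tendsto (fun s : ℝ => tailExponent φ s / (s : EReal)) atTop (𝓝 ⊤)) {β : ℝ}
    (hβ : 0 < β) {a b : ℝ} (hb : 0 < b) :
    ∀ᶠ ε : ℝ in 𝓝[>] 0, a + b * truncationRadius φ ε < -Real.log (ε ^ β + ε) := by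
  have hγ : 0 < min β 1 := lt_min hβ one_pos
  -- With this `η`, half of the logarithmic growth absorbs `b * truncationRadius φ ε`; the other
  -- half beats the constants.
  obtain ⟨S, hS⟩ := truncationRadius_le_of_tendsto hp (η := min β 1 / (2 * b)) (by positivity)
  have hlog : Tendsto (fun ε : ℝ => min β 1 / 2 * (-Real.log ε)) (𝓝[>] 0) atTop :=
    (tendsto_neg_atBot_atTop.comp Real.tendsto_log_nhdsGT_zero).const_mul_atTop (by positivity)
  filter_upwards [hlog.eventually_gt_atTop (a + b * S + Real.log 2),
    Ioo_mem_nhdsGT one_pos] with ε hε hε1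
  have h1 := (hS ε hε1.1 hε1.2).2
  have h2 := neg_log_rpow_add_self_ge (β := β) hε1.1 hε1.2
  have h3 : b * truncationRadius φ ε ≤ b * S + min β 1 / 2 * (-Real.log ε) := by
    calc b * truncationRadius φ ε ≤ b * (S + min β 1 / (2 * b) * (-Real.log ε)) := by gcongr
      _ = _ := by field_simp
  linarith

/-- The radius equation is solvable as soon as its right side is nonnegative. -/
theorem exists_radiusEquation {φ : ℝ → ℂ} {q β ε : ℝ} (hq : 1 / 2 < q)
    (hs : 0 < truncationRadius φ ε) (hε : 0 ≤ -Real.log (ε ^ β + ε)) :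
    ∃ R : ℝ, 0 < R ∧ RadiusEquation φ q β ε R := by
  have hq' : 0 < q + 1 / 2 := by linarith
  set L : ℝ := Real.log (15 * Real.exp 1 ^ 3) with hL
  set a : ℝ := Real.log (∫ t : ℝ, ‖φ t‖) with ha
  set b : ℝ := 2 * Real.exp 1 * truncationRadius φ ε with hb
  have hb0 : 0 < b := by positivity
  set G : ℝ → ℝ := fun R => ((q + 1 / 2) * Real.log R + L) * (a + b * R) with hG
  -- The zero of the logarithmic factor serves as lower endpoint for the intermediate value theorem.
  set R₁ : ℝ := Real.exp (-L / (q + 1 / 2)) with hR₁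
  have hG1 : G R₁ = 0 := by
    simp only [hG, hR₁, Real.log_exp]
    field_simp
    simp
  have hlim : Tendsto G atTop atTop :=
    (tendsto_atTop_add_const_right _ _ (Real.tendsto_log_atTop.const_mul_atTop hq')).atTop_mul_atTop₀
      (tendsto_atTop_add_const_left _ _ (tendsto_id.const_mul_atTop hb0))
  obtain ⟨R₂, hR₂, hR₁₂⟩ := ((hlim.eventually_ge_atTop (-Real.log (ε ^ β + ε))).and
    (eventually_ge_atTop R₁)).exists
  have hcont : ContinuousOn G (Set.Icc R₁ R₂) := by
    have hne : ∀ x ∈ Set.Icc R₁ R₂, x ≠ 0 := fun x hx => ((Real.exp_pos _).trans_le hx.1).ne'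
    exact ((continuousOn_const.mul (continuousOn_id.log hne)).add continuousOn_const).mul
      (by fun_prop)
  obtain ⟨R, hR, hGR⟩ := intermediate_value_Icc hR₁₂ hcont ⟨hG1.trans_le hε, hR₂⟩
  exact ⟨R, (Real.exp_pos _).trans_le hR.1, hGR⟩

/-- For tiny radii the trivial bound suffices. -/
theorem volume_smallValueSet_le_of_log_neg (φ : ℝ → ℂ) {q δ R : ℝ} (hR : 0 < R)
    (hneg : (q + 1 / 2) * Real.log R + Real.log (15 * Real.exp 1 ^ 3) < 0) :
    volume (smallValueSet φ δ R) ≤ ENNReal.ofReal (R ^ (-q + 1 / 2)) := by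
  refine (measure_mono (smallValueSet_subset φ δ R)).trans ?_
  rw [Real.volume_Icc]
  refine ENNReal.ofReal_le_ofReal ?_
  have h2 : Real.log 2 ≤ Real.log (15 * Real.exp 1 ^ 3) :=
    Real.log_le_log two_pos
      (by linarith [one_le_pow₀ (Real.one_le_exp (zero_le_one (α := ℝ))) (n := 3)])
  have h3 : R ^ (q + 1 / 2) ≤ 1 / 2 := by
    rw [← Real.log_le_log_iff (Real.rpow_pos_of_pos hR _) (by norm_num), Real.log_rpow hR,
      one_div, Real.log_inv]
    linarith
  have h4 : R = R ^ (q + 1 / 2) * R ^ (-q + 1 / 2) := by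
    rw [← Real.rpow_add hR, add_add_add_comm, add_neg_cancel, add_halves, zero_add, Real.rpow_one]
  have h5 := mul_le_mul_of_nonneg_right h3 (Real.rpow_nonneg hR.le (-q + 1 / 2))
  linarith

/-! ### Conclusion -/

/-- For large radii the solution of the radius equation controls the small-value set. -/
theorem eventually_volume_smallValueSet_le {φ : ℝ → ℂ} (hφ : Integrable φ) {x₀ q s₁ : ℝ}
    (hx₀ : fourierHat φ x₀ ≠ 0) (hq : 1 / 2 < q) (hs₁ : 0 < s₁) :
    ∀ᶠ R : ℝ in atTop, ∀ β ε : ℝ, 0 < ε → ε ≤ ‖fourierHat φ x₀‖ / 2 →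
      {s : ℝ | 0 < s ∧ EReal.exp (-tailExponent φ s) ≤ ENNReal.ofReal ε}.Nonempty →
      s₁ ≤ truncationRadius φ ε → RadiusEquation φ q β ε R →
      volume (smallValueSet φ (ε ^ β) R) ≤ ENNReal.ofReal (R ^ (-q + 1 / 2)) := by
  have hc : 0 < ‖fourierHat φ x₀‖ := norm_pos_iff.2 hx₀
  -- Halving leaves room for the truncation error at `x₀` and makes `c < A` strict.
  have hcA : ‖fourierHat φ x₀‖ / 2 < ∫ t, ‖φ t‖ := by
    linarith [norm_fourierHat_le φ x₀]
  filter_upwards [eventually_lt_log_of_norm_le_on x₀ hq (half_pos hc) hcA hs₁,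
    eventually_ge_atTop 0] with R hR hR0
  intro β ε hε hεc hne hs heq
  have hs0 : 0 < truncationRadius φ ε := hs₁.trans_le hs
  -- An admissible radius within ten percent of the infimum suffices, so attainment is not needed.
  obtain ⟨s', ⟨hs'0, hs'ε⟩, hs's⟩ :=
    exists_lt_of_csInf_lt hne (show truncationRadius φ ε < 11 / 10 * truncationRadius φ ε by linarith)
  set ψ : ℝ → ℂ := {t : ℝ | s' ≤ |t|}ᶜ.indicator φ with hψ
  have hψint : Integrable ψ := hφ.indicator (measurableSet_le_abs s').compl
  have hψ0 : ∀ t, s' < |t| → ψ t = 0 := fun t ht =>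
    Set.indicator_of_notMem (Set.notMem_compl_iff.2 (show t ∈ {t : ℝ | s' ≤ |t|} from ht.le)) φ
  have hψnorm : ∫ t, ‖ψ t‖ ≤ ∫ t, ‖φ t‖ :=
    integral_mono hψint.norm hφ.norm fun t => norm_indicator_le_norm_self φ t
  have hdiff := norm_fourierHat_sub_truncation_le hφ hε.le hs'ε
  by_contra! hlt
  have hm : R ^ (-q + 1 / 2) < volume.real (smallValueSet φ (ε ^ β) R) := by
    have hfin : volume (smallValueSet φ (ε ^ β) R) ≠ ⊤ :=
      ((measure_mono (smallValueSet_subset φ _ R)).trans_lt (by simp)).ne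
    exact (ENNReal.ofReal_lt_iff_lt_toReal (Real.rpow_nonneg hR0 _) hfin).1 hlt
  have key := hR (truncationRadius φ ε) s' hs hs'0.le hs's.le (fourierLaplace ψ)
    (differentiable_fourierLaplace hψint hs'0.le hψ0)
    (by
      rw [fourierLaplace_ofReal]
      have h1 := hdiff x₀
      have h2 := norm_sub_norm_le (fourierHat φ x₀) (fourierHat ψ x₀)
      linarith)
    (fun z => (norm_fourierLaplace_le hψint hψ0 z).trans (by gcongr))
    (smallValueSet φ (ε ^ β) R) (smallValueSet_subset φ _ R) hm (ε ^ β + ε)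
    (fun x hx => by
      rw [fourierLaplace_ofReal]
      have h1 := hdiff x
      have h2 := norm_sub_norm_le (fourierHat ψ x) (fourierHat φ x)
      rw [norm_sub_rev] at h2
      linarith [hx.1])
  rw [RadiusEquation] at heq
  linarith

end Deconvolution

theorem theorem5 (φ : ℝ → ℂ) (hφ : Integrable φ volume) (hφ0 : ¬ φ =ᵐ[volume] 0)
    (hp : Tendsto (fun s : ℝ => Deconvolution.tailExponent φ s / (s : EReal)) atTop (𝓝 ⊤))
    (q β : ℝ) (hq : 1 / 2 < q) (hβ : 0 < β) :
    ∃ ε₀ : ℝ, 0 < ε₀ ∧ ∀ ε : ℝ, 0 < ε → ε < ε₀ →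
      (∃ R : ℝ, 0 < R ∧ Deconvolution.RadiusEquation φ q β ε R) ∧
      ∀ R : ℝ, 0 < R → Deconvolution.RadiusEquation φ q β ε R →
        volume (Deconvolution.smallValueSet φ (ε ^ β) R) ≤ ENNReal.ofReal (R ^ (-q + 1 / 2)) := by
  open Deconvolution in
  obtain ⟨x₀, hx₀⟩ := exists_fourierHat_ne_zero hφ hφ0
  obtain ⟨s₁, hs₁, ε₁, hε₁, hs⟩ := exists_le_truncationRadius hφ hφ0
  obtain ⟨S, hS⟩ := truncationRadius_le_of_tendsto hp one_pos
  obtain ⟨R₀, hR₀⟩ := eventually_atTop.1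
    (eventually_volume_smallValueSet_le hφ hx₀ hq hs₁)
  set M : ℝ := max R₀ 1 with hM
  have hM1 : 1 ≤ M := le_max_right _ _
  set L : ℝ := Real.log (15 * Real.exp 1 ^ 3) with hL
  have hL0 : 0 < L := log_fifteen_mul_exp_pos
  set LM : ℝ := (q + 1 / 2) * Real.log M + L with hLM
  have hLM0 : 0 < LM :=
    add_pos_of_nonneg_of_pos (mul_nonneg (by linarith) (Real.log_nonneg hM1)) hL0
  have hev := (eventually_mul_truncationRadius_lt hp hβ
      (a := LM * |Real.log (∫ t : ℝ, ‖φ t‖)|) (b := LM * (2 * Real.exp 1 * M))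
      (by positivity)).and
    (Ioo_mem_nhdsGT
      (lt_min (lt_min hε₁ one_pos) (half_pos (norm_pos_iff.2 hx₀))))
  obtain ⟨ε₀, hε₀, hsub⟩ := mem_nhdsGT_iff_exists_Ioo_subset.1 hev
  refine ⟨ε₀, hε₀, fun ε hε hεlt => ?_⟩
  obtain ⟨hdom, -, hεmin⟩ := hsub ⟨hε, hεlt⟩
  rw [lt_min_iff, lt_min_iff] at hεmin
  have hne := (hS ε hε hεmin.1.2).1
  have hsε := hs ε hεmin.1.1 hne
  have hs0 : 0 < truncationRadius φ ε := hs₁.trans_le hsε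
  have hrhs : 0 < -Real.log (ε ^ β + ε) := lt_of_le_of_lt (by positivity) hdom
  refine ⟨exists_radiusEquation hq hs0 hrhs.le, fun R hR heq => ?_⟩
  rcases lt_or_ge ((q + 1 / 2) * Real.log R + L) 0 with hneg | hnn
  · exact volume_smallValueSet_le_of_log_neg φ hR hneg
  · refine hR₀ R ?_ β ε hε hεmin.2.le hne hsε heq
    -- For `R ≤ M` with nonnegative logarithmic factor, the left side is at most a fixed affine
    -- function of the truncation radius, which `hdom` puts strictly below the right side.
    by_contra! hlt
    have hRM : R ≤ M := hlt.le.trans (le_max_left _ _)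
    have h1 : (q + 1 / 2) * Real.log R + L ≤ LM := by
      have := mul_le_mul_of_nonneg_left (Real.log_le_log hR hRM) (by linarith : 0 ≤ q + 1 / 2)
      linarith
    have h2 : Real.log (∫ t : ℝ, ‖φ t‖) + 2 * Real.exp 1 * truncationRadius φ ε * R ≤
        |Real.log (∫ t : ℝ, ‖φ t‖)| + 2 * Real.exp 1 * truncationRadius φ ε * M := by
      gcongr
      exact le_abs_self _
    have h3 := mul_le_mul_of_nonneg_left h2 hnn
    have h4 := mul_le_mul_of_nonneg_right h1 (by positivity :
      0 ≤ |Real.log (∫ t : ℝ, ‖φ t‖)| + 2 * Real.exp 1 * truncationRadius φ ε * M)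
    rw [RadiusEquation] at heq
    linarith
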